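/- Let $n \ge 0$ and let $U_n = \mathrm{GL}_n(\mathbb{Z})$ be the unimodular group of degree $n$, that is, the group of all $n \times n$ matrices with integer entries and determinant $\pm 1$. Then every soluble subgroup $G$ of $U_n$ is polycyclic: there is a finite series of subgroups $$G = G_0 \ge G_1 \ge \cdots \ge G_r = 1$$ such that, for each $i = 1, \ldots, r$, $G_i$ is normal in $G_{i-1}$ and the factor group $G_{i-1}/G_i$ is cyclic. -/

import Mathlib

/-- A group `G` is polycyclic if it has a finite series of subgroups
`G = S 0 ≥ S 1 ≥ ⋯ ≥ S r = 1` such that, for each `i < r`, the subgroup `S (i + 1)` is normal in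
`S i` and the factor group `S i / S (i + 1)` is cyclic. (Only `S 0, …, S r` matter.) -/
def IsPolycyclic (G : Type*) [Group G] : Prop :=
  ∃ (r : ℕ) (S : ℕ → Subgroup G), S 0 = ⊤ ∧ S r = ⊥ ∧
    ∀ i < r, S (i + 1) ≤ S i ∧
      ∃ _ : ((S (i + 1)).subgroupOf (S i)).Normal,
        IsCyclic (S i ⧸ (S (i + 1)).subgroupOf (S i))

/-! A soluble group all of whose subgroups are finitely generated is polycyclic: each factor of its
derived series is finitely generated abelian, so the series refines to one with cyclic factors. It
remains to bound generators, and the property `AllSubgroupsFG` passes to subgroups, extensions and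
overgroups of finite index.

The group acts on a rational space preserving a lattice, and the argument is by induction on
dimension (`allSubgroupsFG_of_isSolvable`). If some subgroup of finite index leaves a proper nonzero
subspace W invariant, it acts on W and V/W, both again with lattices; the elements acting trivially
on both form an abelian group embedded in the additive group of endomorphisms of the lattice
(`allSubgroupsFG_ker`).

Otherwise the group is virtually abelian (`IsStronglyIrreducible.exists_abelian`). An irreducible
abelian group spans a number field, and preserving a lattice makes its elements units of the ring of
integers, a finitely generated group by Dirichlet's theorem
(`allSubgroupsFG_of_abelian_irreducible`). -/

/-- Every subgroup of `G` is finitely generated. -/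
def AllSubgroupsFG (G : Type*) [Group G] : Prop :=
  ∀ K : Subgroup G, K.FG

/-! ### Finite generation of all subgroups, and polycyclic series -/

section GroupTheory

open scoped commutatorElement

variable {G Q : Type*} [Group G] [Group Q]

theorem AllSubgroupsFG.of_injective (f : G →* Q) (hf : Function.Injective f)
    (hQ : AllSubgroupsFG Q) : AllSubgroupsFG G := by
  intro K
  have h := hQ (K.map f)
  rw [← Group.fg_iff_subgroup_fg] at h ⊢
  have e := K.equivMapOfInjective f hf
  exact Group.fg_of_surjective (f := e.symm.toMonoidHom) e.symm.surjective

theorem AllSubgroupsFG.inf_fg {N : Subgroup G} (hN : AllSubgroupsFG N) (K : Subgroup G) :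
    (K ⊓ N).FG := by
  have h := hN (K.subgroupOf N)
  rw [← Group.fg_iff_subgroup_fg] at h ⊢
  have e := (K.subgroupOf N).equivMapOfInjective N.subtype N.subtype_injective
  have h2 : Group.FG ((K.subgroupOf N).map N.subtype) :=
    Group.fg_of_surjective (f := e.toMonoidHom) e.surjective
  rwa [Subgroup.subgroupOf_map_subtype] at h2

/-- Lifts to K of generators of `f(K)`, together with generators of `K ⊓ f.ker`, generate K. -/
theorem AllSubgroupsFG.of_hom (f : G →* Q) (hQ : AllSubgroupsFG Q)
    (hk : AllSubgroupsFG f.ker) : AllSubgroupsFG G := by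
  classical
  intro K
  obtain ⟨S, hS⟩ := hQ (K.map f)
  have hSK : (S : Set Q) ⊆ f '' (K : Set G) := by
    rw [← Subgroup.coe_map, ← hS]; exact Subgroup.subset_closure
  obtain ⟨T, hTK, hTS⟩ := Finset.subset_set_image_iff.mp hSK
  have hfg : (Subgroup.closure (T : Set G) ⊔ (K ⊓ f.ker)).FG :=
    Subgroup.FG.sup ⟨T, rfl⟩ (hk.inf_fg K)
  convert hfg
  apply le_antisymm
  · intro x hx
    have h1 : f x ∈ (Subgroup.closure (T : Set G)).map f := by
      rw [MonoidHom.map_closure, ← Finset.coe_image, hTS, hS]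
      exact ⟨x, hx, rfl⟩
    obtain ⟨y, hy, hyx⟩ := h1
    have hyK : y ∈ K := (Subgroup.closure_le K).mpr hTK hy
    rw [show x = y * (y⁻¹ * x) by group]
    refine Subgroup.mul_mem_sup hy ⟨K.mul_mem (K.inv_mem hyK) hx, ?_⟩
    simp [hyx]
  · exact sup_le ((Subgroup.closure_le K).mpr hTK) inf_le_left

/-- K is generated by `K ⊓ N` and finitely many coset representatives. -/
theorem AllSubgroupsFG.of_finiteIndex (N : Subgroup G) [N.FiniteIndex]
    (hN : AllSubgroupsFG N) : AllSubgroupsFG G := by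
  classical
  intro K
  have hfin : Finite (K ⧸ N.subgroupOf K) := inferInstance
  have : Fintype (K ⧸ N.subgroupOf K) := Fintype.ofFinite _
  let T : Finset G := Finset.univ.image fun q : K ⧸ N.subgroupOf K => (q.out : G)
  have hTK : (T : Set G) ⊆ K := by
    intro x hx
    obtain ⟨q, -, rfl⟩ := Finset.mem_image.mp (Finset.mem_coe.mp hx)
    exact q.out.2
  have hfg : (Subgroup.closure (T : Set G) ⊔ (K ⊓ N)).FG :=
    Subgroup.FG.sup ⟨T, rfl⟩ (hN.inf_fg K)
  convert hfg
  apply le_antisymm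
  · intro x hx
    set y : K := (QuotientGroup.mk ⟨x, hx⟩ : K ⧸ N.subgroupOf K).out with hy
    have h1 : y⁻¹ * ⟨x, hx⟩ ∈ N.subgroupOf K := by
      rw [← QuotientGroup.eq, hy, QuotientGroup.out_eq']
    rw [show x = y * ((y : G)⁻¹ * x) by group]
    refine Subgroup.mul_mem_sup (Subgroup.subset_closure ?_)
      ⟨K.mul_mem (K.inv_mem y.2) hx, by simpa [Subgroup.mem_subgroupOf] using h1⟩
    exact Finset.mem_coe.mpr (Finset.mem_image_of_mem _ (Finset.mem_univ _))
  · exact sup_le ((Subgroup.closure_le K).mpr hTK) inf_le_left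

theorem AllSubgroupsFG.of_commGroup (A : Type*) [CommGroup A] [hA : Group.FG A] :
    AllSubgroupsFG A := by
  intro K
  rw [Subgroup.fg_iff_add_fg]
  have h : Module.Finite ℤ (Additive A) := by
    rw [Module.Finite.iff_addGroup_fg]; infer_instance
  have h2 : IsNoetherian ℤ (Additive A) := isNoetherian_of_isNoetherianRing_of_finite ℤ _
  have h3 := h2.noetherian (AddSubgroup.toIntSubmodule K.toAddSubgroup)
  rw [Submodule.fg_iff_addSubgroup_fg] at h3
  simpa using h3

/-- `K` is a normal subgroup of `H` with cyclic factor group. -/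
def CyclicStep (H K : Subgroup G) : Prop :=
  K ≤ H ∧ ∃ _ : (K.subgroupOf H).Normal, IsCyclic (H ⧸ K.subgroupOf H)

theorem isPolycyclic_of_reflTransGen
    (h : Relation.ReflTransGen CyclicStep (⊤ : Subgroup G) ⊥) : IsPolycyclic G := by
  suffices ∀ H : Subgroup G, Relation.ReflTransGen CyclicStep H ⊥ →
      ∃ (r : ℕ) (S : ℕ → Subgroup G), S 0 = H ∧ S r = ⊥ ∧
        ∀ i < r, CyclicStep (S i) (S (i + 1)) from this _ h
  intro H hH
  induction hH using Relation.ReflTransGen.head_induction_on with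
  | refl => exact ⟨0, fun _ => ⊥, rfl, rfl, by simp⟩
  | @head a b hab _ ih =>
    obtain ⟨r, S, h0, hr, hS⟩ := ih
    refine ⟨r + 1, fun i => Nat.casesOn i a S, rfl, hr, ?_⟩
    rintro (_ | i) hi
    · simpa [h0] using hab
    · exact hS i (by omega)

theorem CyclicStep.of_sup_zpowers {H K : Subgroup G} (hKH : K ≤ H)
    (hcomm : ∀ x ∈ H, ∀ y ∈ H, ⁅x, y⁆ ∈ K) (a : G) (hH : H ≤ K ⊔ Subgroup.zpowers a)
    (ha : a ∈ H) : CyclicStep H K := by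
  have hn : (K.subgroupOf H).Normal := by
    refine ⟨fun x hx g => ?_⟩
    rw [Subgroup.mem_subgroupOf] at hx ⊢
    have := K.mul_mem (hcomm g g.2 x x.2) hx
    simpa [commutatorElement_def] using this
  refine ⟨hKH, hn, ⟨QuotientGroup.mk ⟨a, ha⟩, ?_⟩⟩
  intro q
  obtain ⟨x, rfl⟩ := QuotientGroup.mk_surjective q
  have key : H ≤ (Subgroup.comap (QuotientGroup.mk' (K.subgroupOf H))
      (Subgroup.zpowers (QuotientGroup.mk ⟨a, ha⟩))).map H.subtype := by
    refine hH.trans (sup_le ?_ ?_)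
    · intro y hy
      refine ⟨⟨y, hKH hy⟩, ?_, rfl⟩
      have : (QuotientGroup.mk ⟨y, hKH hy⟩ : H ⧸ K.subgroupOf H) = 1 := by
        rw [QuotientGroup.eq_one_iff]; exact hy
      simp [this]
    · rw [Subgroup.zpowers_le]
      exact ⟨⟨a, ha⟩, Subgroup.mem_zpowers _, rfl⟩
  obtain ⟨y, hy, hyx⟩ := key x.2
  have : y = x := Subtype.ext hyx
  subst this
  exact hy

/-- The generators in S are adjoined to D one at a time. Every intermediate group contains all
commutators, so it is normal in the next, and the factor is generated by the one new element. -/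
theorem reflTransGen_sup_closure (D : Subgroup G) (S : Finset G)
    (hcomm : ∀ x ∈ D ⊔ Subgroup.closure (S : Set G), ∀ y ∈ D ⊔ Subgroup.closure (S : Set G),
      ⁅x, y⁆ ∈ D) :
    Relation.ReflTransGen CyclicStep (D ⊔ Subgroup.closure (S : Set G)) D := by
  classical
  induction S using Finset.induction_on with
  | empty => simp [Relation.ReflTransGen.refl]
  | insert a S _ ih =>
    have hle : D ⊔ Subgroup.closure (S : Set G) ≤
        D ⊔ Subgroup.closure ((insert a S : Finset G) : Set G) :=
      sup_le_sup_left (Subgroup.closure_mono (by simp)) D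
    refine Relation.ReflTransGen.head (CyclicStep.of_sup_zpowers hle ?_ a ?_ ?_)
      (ih fun x hx y hy => hcomm x (hle hx) y (hle hy))
    · exact fun x hx y hy => Subgroup.mem_sup_left (hcomm x hx y hy)
    · rw [Finset.coe_insert, Set.insert_eq, Subgroup.closure_union, ← Subgroup.zpowers_eq_closure,
        sup_assoc, sup_comm (Subgroup.zpowers a)]
    · exact Subgroup.mem_sup_right (Subgroup.subset_closure (by simp))

theorem AllSubgroupsFG.isPolycyclic (hG : AllSubgroupsFG G) (hs : Group.IsSolvable G) :
    IsPolycyclic G := by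
  apply isPolycyclic_of_reflTransGen
  obtain ⟨n, hn⟩ := hs.solvable
  rw [← hn]
  clear hn
  induction n with
  | zero => exact Relation.ReflTransGen.refl
  | succ n ih =>
    refine ih.trans ?_
    obtain ⟨S, hS⟩ := hG (derivedSeries G n)
    have h : derivedSeries G (n + 1) ⊔ Subgroup.closure (S : Set G) = derivedSeries G n := by
      rw [hS]; exact sup_eq_right.mpr (derivedSeries_antitone G (Nat.le_succ n))
    have := reflTransGen_sup_closure (derivedSeries G (n + 1)) S (by
      rw [h]
      exact fun x hx y hy => Subgroup.commutator_mem_commutator hx hy)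
    rwa [h] at this

theorem Subgroup.finiteIndex_of_finite_range {X : Type*} (K : Subgroup G) (f : G → X)
    (hf : (Set.range f).Finite) (h : ∀ g g', f g = f g' → g⁻¹ * g' ∈ K) : K.FiniteIndex := by
  have : Finite (Set.range f) := hf
  have : Finite (G ⧸ K) := by
    refine Finite.of_injective (fun q : G ⧸ K => (⟨f q.out, q.out, rfl⟩ : Set.range f)) ?_
    intro p q hpq
    rw [← QuotientGroup.out_eq' p, ← QuotientGroup.out_eq' q, QuotientGroup.eq]
    exact h _ _ (congrArg Subtype.val hpq)
  exact Subgroup.finiteIndex_of_finite_quotient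

end GroupTheory

/-! ### Irreducible linear groups and the fields they generate -/

section LinearGroups

open scoped IsMulCommutative

universe u v

variable {k : Type v} [Field k] {V : Type u} [AddCommGroup V] [Module k V]

theorem commute_of_mem_adjoin {A : Type*} [Ring A] [Algebra k A] {S : Set A} {x : A}
    (h : ∀ s ∈ S, Commute x s) {y : A} (hy : y ∈ Algebra.adjoin k S) : Commute x y := by
  have hle : Algebra.adjoin k S ≤ Subalgebra.centralizer k {x} :=
    Algebra.adjoin_le fun s hs => by
      rw [SetLike.mem_coe, Subalgebra.mem_centralizer_iff]
      rintro _ rfl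
      exact h s hs
  exact (Subalgebra.mem_centralizer_iff k).mp (hle hy) x rfl

/-- Conjugation by a unit, as an algebra homomorphism. -/
def unitConj {A : Type*} [Ring A] [Algebra k A] (g : Aˣ) : A →ₐ[k] A where
  toFun x := g * x * (g⁻¹ : Aˣ)
  map_one' := by simp
  map_mul' x y := by simp [mul_assoc]
  map_zero' := by simp
  map_add' x y := by simp [mul_add, add_mul]
  commutes' r := by
    rw [← Algebra.commutes r (g : A), mul_assoc, Units.mul_inv, mul_one]

/-- `H` leaves no proper nonzero subspace of `V` invariant. -/
def IsIrreducibleGroup (H : Subgroup (Module.End k V)ˣ) : Prop :=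
  ∀ W : Submodule k V, (∀ h ∈ H, ∀ w ∈ W, (h : Module.End k V) w ∈ W) → W = ⊥ ∨ W = ⊤

/-- Every subgroup of finite index in `H` is irreducible. -/
def IsStronglyIrreducible (H : Subgroup (Module.End k V)ˣ) : Prop :=
  ∀ N ≤ H, N.relIndex H ≠ 0 → IsIrreducibleGroup N

theorem IsStronglyIrreducible.isIrreducibleGroup {H : Subgroup (Module.End k V)ˣ}
    (hH : IsStronglyIrreducible H) : IsIrreducibleGroup H :=
  hH H le_rfl (by simp)

/-- Schur's lemma: the kernel of e is invariant under H. -/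
theorem IsIrreducibleGroup.injective_of_commute {H : Subgroup (Module.End k V)ˣ}
    (hH : IsIrreducibleGroup H) {e : Module.End k V}
    (he : ∀ h ∈ H, Commute e (h : Module.End k V)) (h0 : e ≠ 0) : Function.Injective e := by
  have h1 := hH (LinearMap.ker e) (fun h hh w hw => by
    rw [LinearMap.mem_ker] at hw ⊢
    rw [← Module.End.mul_apply, (he h hh).eq, Module.End.mul_apply, hw, map_zero])
  rcases h1 with h1 | h1
  · exact LinearMap.ker_eq_bot.mp h1
  · exact absurd (LinearMap.ker_eq_top.mp h1) h0

/-- The elements mapping the subspace `W` onto itself. -/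
def submoduleStabilizer (W : Submodule k V) : Subgroup (Module.End k V)ˣ where
  carrier := {g | W.map (g : Module.End k V) = W}
  one_mem' := by simp [Module.End.one_eq_id]
  mul_mem' {a b} ha hb := by
    simp only [Set.mem_ofPred_eq, Units.val_mul, Module.End.mul_eq_comp, Submodule.map_comp] at *
    rw [hb, ha]
  inv_mem' {a} ha := by
    simp only [Set.mem_ofPred_eq] at *
    conv_lhs => rw [← ha]
    rw [← Submodule.map_comp, ← Module.End.mul_eq_comp, Units.inv_mul, Module.End.one_eq_id,
      Submodule.map_id]

/-- An infinite index counts as 0, so `relIndex ≠ 0` expresses finite index throughout. -/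
theorem relIndex_ne_zero_of_finite_image {G X : Type*} [Group G] (H K : Subgroup G) (f : G → X)
    (hf : (f '' H).Finite) (h : ∀ g ∈ H, ∀ g' ∈ H, f g = f g' → g⁻¹ * g' ∈ K) :
    K.relIndex H ≠ 0 := by
  have := Subgroup.finiteIndex_of_finite_range (K.subgroupOf H) (fun g : H => f g)
    (hf.subset (by rintro _ ⟨g, rfl⟩; exact ⟨g, g.2, rfl⟩))
    (fun g g' hgg => h g g.2 g' g'.2 hgg)
  exact this.index_ne_zero

/-- The stabilizer of W in H has finite index, hence is itself irreducible. -/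
theorem IsStronglyIrreducible.eq_top_of_finite_orbit {H : Subgroup (Module.End k V)ˣ}
    (hH : IsStronglyIrreducible H) {W : Submodule k V} (hW : W ≠ ⊥)
    (hfin : ((fun h : (Module.End k V)ˣ => W.map (h : Module.End k V)) '' H).Finite) :
    W = ⊤ := by
  have h1 : (submoduleStabilizer W).relIndex H ≠ 0 := by
    refine relIndex_ne_zero_of_finite_image H _ _ hfin fun g _ g' _ hgg => ?_
    change W.map ((g⁻¹ * g' : (Module.End k V)ˣ) : Module.End k V) = W
    rw [Units.val_mul, Module.End.mul_eq_comp, Submodule.map_comp]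
    rw [← hgg, ← Submodule.map_comp, ← Module.End.mul_eq_comp, Units.inv_mul,
      Module.End.one_eq_id, Submodule.map_id]
  rw [← Subgroup.inf_relIndex_left] at h1
  refine (hH _ inf_le_left h1 W fun h hh w hw => ?_).resolve_left hW
  have h2 : W.map (h : Module.End k V) = W := hh.2
  rw [← h2]
  exact Submodule.mem_map_of_mem hw

theorem unitConj_mem_adjoin {A : Type*} [Ring A] [Algebra k A] {S : Set A} {g : Aˣ}
    (h : ∀ s ∈ S, unitConj (k := k) g s ∈ S) {x : A} (hx : x ∈ Algebra.adjoin k S) :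
    unitConj (k := k) g x ∈ Algebra.adjoin k S := by
  have hle : Algebra.adjoin k S ≤ (Algebra.adjoin k S).comap (unitConj g) :=
    Algebra.adjoin_le fun s hs => Algebra.subset_adjoin (h s hs)
  exact hle hx

variable [FiniteDimensional k V]

theorem exists_field_of_noZeroDivisors [Nontrivial V] {S : Set (Module.End k V)}
    (hcomm : ∀ a ∈ S, ∀ b ∈ S, a * b = b * a)
    (hdom : ∀ a ∈ Algebra.adjoin k S, ∀ b ∈ Algebra.adjoin k S, a * b = 0 → a = 0 ∨ b = 0) :
    ∃ (K : Type u) (_ : Field K) (_ : Algebra k K) (φ : K →ₐ[k] Module.End k V),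
      FiniteDimensional k K ∧ Function.Injective φ ∧ φ.range = Algebra.adjoin k S := by
  have := Algebra.isMulCommutative_adjoin k hcomm
  have : NoZeroDivisors (Algebra.adjoin k S) := ⟨fun {a b} hab => by
    simpa using hdom a a.2 b b.2 (by simpa using congrArg Subtype.val hab)⟩
  have : IsDomain (Algebra.adjoin k S) := NoZeroDivisors.to_isDomain _
  have : IsArtinianRing (Algebra.adjoin k S) := IsArtinianRing.of_finite k _
  have hf : IsField (Algebra.adjoin k S) := IsArtinianRing.isField_of_isDomain _
  let := hf.toField
  exact ⟨Algebra.adjoin k S, inferInstance, inferInstanceAs (Algebra k (Algebra.adjoin k S)),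
    (Algebra.adjoin k S).val, inferInstanceAs (FiniteDimensional k (Algebra.adjoin k S)),
    Subtype.val_injective, Subalgebra.range_val _⟩

theorem IsIrreducibleGroup.exists_field [Nontrivial V] {H : Subgroup (Module.End k V)ˣ}
    (hH : IsIrreducibleGroup H) {S : Set (Module.End k V)}
    (hcomm : ∀ a ∈ S, ∀ b ∈ S, a * b = b * a)
    (hS : ∀ a ∈ S, ∀ h ∈ H, Commute (h : Module.End k V) a) :
    ∃ (K : Type u) (_ : Field K) (_ : Algebra k K) (φ : K →ₐ[k] Module.End k V),
      FiniteDimensional k K ∧ Function.Injective φ ∧ φ.range = Algebra.adjoin k S := by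
  refine exists_field_of_noZeroDivisors hcomm fun a ha b hb hab => ?_
  by_contra! hne
  have hinj := hH.injective_of_commute
    (fun h hh => (commute_of_mem_adjoin (fun s hs => hS s hs h hh) ha).symm) hne.1
  apply hne.2
  ext v
  apply hinj
  rw [← Module.End.mul_apply, hab]
  simp

/-- A Clifford-type argument. The algebra R generated by S is Artinian, so it has finitely many
primes, and H permutes them by conjugation. The subspace killed by an associated prime therefore has
a finite orbit and must be all of V; as R acts faithfully, that prime is zero and R is a domain. -/
theorem IsStronglyIrreducible.exists_field [Nontrivial V] {H : Subgroup (Module.End k V)ˣ}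
    (hH : IsStronglyIrreducible H) {S : Set (Module.End k V)}
    (hcomm : ∀ a ∈ S, ∀ b ∈ S, a * b = b * a)
    (hconj : ∀ h ∈ H, ∀ s ∈ S, unitConj (k := k) h s ∈ S) :
    ∃ (K : Type u) (_ : Field K) (_ : Algebra k K) (φ : K →ₐ[k] Module.End k V),
      FiniteDimensional k K ∧ Function.Injective φ ∧ φ.range = Algebra.adjoin k S := by
  apply exists_field_of_noZeroDivisors hcomm
  have := Algebra.isMulCommutative_adjoin k hcomm
  set R := Algebra.adjoin k S
  have : IsArtinianRing R := IsArtinianRing.of_finite k _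
  obtain ⟨p, hp⟩ := associatedPrimes.nonempty R V
  rw [AssociatedPrimes.mem_iff, isAssociatedPrime_iff] at hp
  obtain ⟨hp, x, hpx⟩ := hp
  let W : Ideal R → Submodule k V := fun q =>
    ⨅ e ∈ q, LinearMap.ker (e : Module.End k V)
  have hWmem : ∀ q v, v ∈ W q ↔ ∀ e ∈ q, (e : Module.End k V) v = 0 := fun q v => by
    simp [W]
  have hxW : x ∈ W p := by
    rw [hWmem]
    intro e he
    rw [hpx, Submodule.mem_colon_singleton, Submodule.mem_bot] at he
    exact he
  have hx0 : x ≠ 0 := by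
    rintro rfl
    exact hp.ne_top (by rw [hpx]; ext; simp)
  have htop : W p = ⊤ := by
    refine hH.eq_top_of_finite_orbit
      (fun h => hx0 (by rw [h] at hxW; exact (Submodule.mem_bot k).mp hxW)) ?_
    refine (Set.finite_range fun q : PrimeSpectrum R => W q.asIdeal).subset ?_
    rintro _ ⟨g, hg, rfl⟩
    let c : ∀ g ∈ H, R →ₐ[k] R := fun g hg =>
      ((unitConj g).comp R.val).codRestrict R fun x => unitConj_mem_adjoin (hconj g hg) x.2
    have hc : ∀ g (hg : g ∈ H) (e : R), (c g hg e : Module.End k V) =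
      g * e * (g⁻¹ : (Module.End k V)ˣ) := fun g hg e => rfl
    have hg' : g⁻¹ ∈ H := H.inv_mem hg
    -- The translate of `W p` by g is the subspace killed by the conjugate prime g p g⁻¹.
    refine ⟨⟨p.comap (c g⁻¹ hg'), hp.comap _⟩, ?_⟩
    ext v
    simp only
    rw [hWmem, Submodule.mem_map]
    constructor
    · intro hv
      refine ⟨(g⁻¹ : (Module.End k V)ˣ).val v, ?_, ?_⟩
      · rw [hWmem]
        intro e he
        have h1 := hv (c g hg e) (by
          rw [Ideal.mem_comap]
          convert he
          apply Subtype.ext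
          simp [hc, mul_assoc])
        rw [hc _ hg, mul_assoc, Module.End.mul_apply, Module.End.mul_apply] at h1
        have h2 := congrArg (g⁻¹ : (Module.End k V)ˣ).val h1
        rwa [← Module.End.mul_apply, Units.inv_mul, map_zero] at h2
      · rw [← Module.End.mul_apply, Units.mul_inv, Module.End.one_apply]
    · rintro ⟨w, hw, rfl⟩ e he
      have h1 := (hWmem _ _).mp hw _ he
      rw [hc _ hg', inv_inv, mul_assoc, Module.End.mul_apply, Module.End.mul_apply] at h1
      have h2 := congrArg g.val h1
      rwa [← Module.End.mul_apply, Units.mul_inv, map_zero] at h2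
  have hbot : ∀ e ∈ p, e = 0 := fun e he => by
    apply Subtype.ext
    ext v
    have : v ∈ W p := htop ▸ Submodule.mem_top
    simpa using (hWmem _ _).mp this e he
  intro a ha b hb hab
  have h0 : (⟨a, ha⟩ * ⟨b, hb⟩ : R) = 0 := Subtype.ext hab
  rcases hp.mem_or_mem (h0 ▸ p.zero_mem : (⟨a, ha⟩ * ⟨b, hb⟩ : R) ∈ p) with h | h
  · exact Or.inl (congrArg Subtype.val (hbot _ h))
  · exact Or.inr (congrArg Subtype.val (hbot _ h))

/-- Elements with finitely many conjugates under `H` commute with `H`. -/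
def FiniteConjCentral {G : Type*} [Group G] (H : Subgroup G) : Prop :=
  ∀ x : G, ((fun h => h * x * h⁻¹) '' (H : Set G)).Finite → ∀ h ∈ H, Commute h x

/-- A generates a field K of operators. All H-conjugates of a lie in K and are roots of the minimal
polynomial of a, so they are finite in number. -/
theorem commute_of_abelian_normal [Nontrivial V] {H A : Subgroup (Module.End k V)ˣ}
    (hH : IsStronglyIrreducible H) (hc : FiniteConjCentral H)
    (hA : ∀ a ∈ A, ∀ b ∈ A, a * b = b * a) (hHA : ∀ h ∈ H, ∀ a ∈ A, h * a * h⁻¹ ∈ A)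
    {a h : (Module.End k V)ˣ} (ha : a ∈ A) (hh : h ∈ H) : Commute h a := by
  obtain ⟨K, _, _, φ, _, hφ, hr⟩ := hH.exists_field
    (S := Units.val '' (A : Set (Module.End k V)ˣ))
    (by
      rintro _ ⟨x, hx, rfl⟩ _ ⟨y, hy, rfl⟩
      exact congrArg Units.val (hA x hx y hy))
    (by
      rintro h hh _ ⟨x, hx, rfl⟩
      exact ⟨_, hHA h hh x hx, rfl⟩)
  refine hc a ?_ h hh
  refine Set.Finite.of_finite_image (f := Units.val) ?_ Units.val_injective.injOn
  have hp : minpoly k (a : Module.End k V) ≠ 0 := minpoly.ne_zero (Algebra.IsIntegral.isIntegral _)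
  refine (((minpoly k (a : Module.End k V)).rootSet_finite K).image φ).subset ?_
  rintro _ ⟨_, ⟨g, hg, rfl⟩, rfl⟩
  have hmem : ((g * a * g⁻¹ : (Module.End k V)ˣ) : Module.End k V) ∈ φ.range := by
    rw [hr]
    exact Algebra.subset_adjoin ⟨_, hHA g hg a ha, rfl⟩
  obtain ⟨κ, hκ⟩ := hmem
  refine ⟨κ, ?_, hκ⟩
  rw [Polynomial.mem_rootSet]
  refine ⟨hp, hφ ?_⟩
  have h1 : (φ : K → Module.End k V) κ = unitConj (k := k) g a := hκ
  rw [← Polynomial.aeval_algHom_apply, h1, Polynomial.aeval_algHom_apply, minpoly.aeval, map_zero,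
    map_zero]

/-- With V regarded as a K-space through φ, both g and h are K-linear. Taking determinants over K in
h g = ζ g h gives ζ ^ m = 1 for m = dim V over K. -/
theorem exists_pow_eq_one_of_conj_eq_smul [Nontrivial V] {K : Type*} [Field K] [Algebra k K]
    (φ : K →ₐ[k] Module.End k V) :
    ∃ m : ℕ, 0 < m ∧ ∀ (ζ : K) (g h : (Module.End k V)ˣ),
      (∀ c, Commute (g : Module.End k V) (φ c)) → (∀ c, Commute (h : Module.End k V) (φ c)) →
      (h * g * (h⁻¹ : (Module.End k V)ˣ) : Module.End k V) = φ ζ * g → ζ ^ m = 1 := by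
  let : Module K V := Module.compHom V φ.toRingHom
  have hsmul : ∀ (c : K) (v : V), c • v = φ c v := fun _ _ => rfl
  have : IsScalarTower k K V := ⟨fun a c v => by simp [hsmul]⟩
  have : FiniteDimensional K V := FiniteDimensional.right k K V
  let lift : ∀ g : Module.End k V, (∀ c, Commute g (φ c)) → Module.End K V := fun g hg =>
    { toFun := g
      map_add' := map_add g
      map_smul' := fun c v => by
        simp only [hsmul, RingHom.id_apply]
        rw [← Module.End.mul_apply, (hg c).eq, Module.End.mul_apply] }
  refine ⟨Module.finrank K V, Module.finrank_pos, fun ζ g h hg hh hgh => ?_⟩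
  have e1 : lift h hh * lift g hg = (ζ • lift g hg) * lift h hh := by
    ext v
    have := congrArg (fun f : Module.End k V => f (h.val v)) hgh
    simp only [Module.End.mul_apply] at this
    rw [← Module.End.mul_apply (h⁻¹ : (Module.End k V)ˣ).val, Units.inv_mul,
      Module.End.one_apply] at this
    exact this
  have hdet : ∀ (x : (Module.End k V)ˣ) (hx : ∀ c, Commute (x : Module.End k V) (φ c)),
      LinearMap.det (lift x hx) ≠ 0 := fun x hx => by
    have hx' : ∀ c, Commute (x⁻¹ : (Module.End k V)ˣ).val (φ c) := fun c => (hx c).units_inv_left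
    have : lift x hx * lift _ hx' = 1 := by
      ext v
      change x.val ((x⁻¹ : (Module.End k V)ˣ).val v) = v
      rw [← Module.End.mul_apply, Units.mul_inv, Module.End.one_apply]
    have h2 := congrArg LinearMap.det this
    rw [map_mul, map_one] at h2
    exact left_ne_zero_of_mul_eq_one h2
  have e2 := congrArg LinearMap.det e1
  rw [map_mul, map_mul, LinearMap.det_smul] at e2
  have h1 := hdet g hg
  have h2 := hdet h hh
  have e3 : (ζ ^ Module.finrank K V - 1) *
      (LinearMap.det (lift g hg) * LinearMap.det (lift h hh)) = 0 := by
    linear_combination -e2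
  rcases mul_eq_zero.mp e3 with h | h
  · exact sub_eq_zero.mp h
  · exact absurd h (mul_ne_zero h1 h2)

/-- The centre of H generates a field by Schur's lemma. A central z of the form h g h⁻¹ g⁻¹ is a
scalar from that field, hence an m-th root of unity for a fixed m. -/
theorem exists_finite_scalars [Nontrivial V] {H : Subgroup (Module.End k V)ˣ}
    (hH : IsIrreducibleGroup H) :
    ∃ F : Set (Module.End k V)ˣ, F.Finite ∧ ∀ z ∈ H, ∀ g ∈ H, ∀ h ∈ H,
      (∀ x ∈ H, Commute x z) → h * g * h⁻¹ = z * g → z ∈ F := by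
  obtain ⟨K, _, _, φ, _, hφ, hr⟩ := hH.exists_field
    (S := Units.val '' {z : (Module.End k V)ˣ | z ∈ H ∧ ∀ x ∈ H, Commute x z})
    (by
      rintro _ ⟨x, hx, rfl⟩ _ ⟨y, hy, rfl⟩
      exact congrArg Units.val (hy.2 x hx.1).eq)
    (by
      rintro _ ⟨x, hx, rfl⟩ h hh
      exact congrArg Units.val (hx.2 h hh).eq)
  obtain ⟨m, hm, hpow⟩ := exists_pow_eq_one_of_conj_eq_smul φ
  have hcomm : ∀ g ∈ H, ∀ c, Commute (g : Module.End k V) (φ c) := fun g hg c => by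
    have hmem : φ c ∈ Algebra.adjoin k
        (Units.val '' {z : (Module.End k V)ˣ | z ∈ H ∧ ∀ x ∈ H, Commute x z}) := by
      rw [← hr]; exact ⟨c, rfl⟩
    refine commute_of_mem_adjoin ?_ hmem
    rintro _ ⟨x, hx, rfl⟩
    exact congrArg Units.val (hx.2 g hg).eq
  refine ⟨Units.val ⁻¹' (φ '' ((Polynomial.X ^ m - 1 : Polynomial K).rootSet K)), ?_, ?_⟩
  · exact ((Polynomial.rootSet_finite _ _).image _).preimage Units.val_injective.injOn
  · intro z hz g hg h hh hzc hgh
    have hmem : (z : Module.End k V) ∈ φ.range := by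
      rw [hr]; exact Algebra.subset_adjoin ⟨z, ⟨hz, hzc⟩, rfl⟩
    obtain ⟨ζ, hζ⟩ := hmem
    refine ⟨ζ, ?_, hζ⟩
    have h1 : φ ζ = z := hζ
    rw [Polynomial.mem_rootSet]
    refine ⟨(Polynomial.monic_X_pow_sub_C 1 hm.ne').ne_zero, ?_⟩
    have := hpow ζ g h (hcomm g hg) (hcomm h hh) (by
      rw [h1]; exact congrArg Units.val hgh)
    simp [this]

end LinearGroups

/-! ### Strongly irreducible soluble groups are virtually abelian -/

section SolvableLinearGroups

open scoped commutatorElement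

universe u v

variable {k : Type v} [Field k] {V : Type u} [AddCommGroup V] [Module k V]

theorem IsStronglyIrreducible.mono {G H : Subgroup (Module.End k V)ˣ}
    (hG : IsStronglyIrreducible G) (hHG : H ≤ G) (hH : H.relIndex G ≠ 0) :
    IsStronglyIrreducible H :=
  fun N hN hN' => hG N (hN.trans hHG) (Subgroup.relIndex_ne_zero_trans hN' hH)

variable [FiniteDimensional k V]

/-- The linear span of B is finite-dimensional, so finitely many elements of B span it, and
commuting with those suffices. -/
theorem exists_finset_commute (B : Subgroup (Module.End k V)ˣ) :
    ∃ s : Finset (Module.End k V)ˣ, (s : Set (Module.End k V)ˣ) ⊆ B ∧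
      ∀ y, (∀ x ∈ s, Commute y x) → ∀ b ∈ B, Commute y b := by
  classical
  obtain ⟨s, hsB, hs⟩ := (Submodule.fg_span_iff_fg_span_finset_subset (R := k)
    (Units.val '' (B : Set (Module.End k V)ˣ))).mp (IsNoetherian.noetherian _)
  obtain ⟨t, htB, rfl⟩ := Finset.subset_set_image_iff.mp hsB
  refine ⟨t, htB, fun y hy b hb => ?_⟩
  have h1 : (b : Module.End k V) ∈ Submodule.span k (Units.val '' (t : Set (Module.End k V)ˣ)) := by
    rw [← Finset.coe_image, ← hs]
    exact Submodule.subset_span ⟨b, hb, rfl⟩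
  have h2 : Commute (y : Module.End k V) b := by
    refine commute_of_mem_adjoin (k := k) ?_ (Algebra.span_le_adjoin k _ h1)
    rintro _ ⟨x, hx, rfl⟩
    exact congrArg Units.val (hy x hx).eq
  exact Units.ext h2.eq

variable [Nontrivial V]

/-- By `FiniteConjCentral` it suffices that b has finitely many H-conjugates. Each conjugate is
determined modulo the centre of B by its action on a finite spanning set s, and that action takes
finitely many values. Two conjugates with the same action differ by an element of the centre of B,
which is central in H and then lies in the finite set F. -/
theorem commute_of_central_commutators {H B : Subgroup (Module.End k V)ˣ}
    (hH : IsStronglyIrreducible H) (hc : FiniteConjCentral H) (hBH : B ≤ H)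
    (hconj : ∀ h ∈ H, ∀ b ∈ B, h * b * h⁻¹ ∈ B)
    (hcomm : ∀ x ∈ B, ∀ y ∈ B, ∀ h ∈ H, Commute h ⁅x, y⁆) {b h : (Module.End k V)ˣ}
    (hb : b ∈ B) (hh : h ∈ H) : Commute h b := by
  obtain ⟨F, hF, hFmem⟩ := exists_finite_scalars hH.isIrreducibleGroup
  -- A B-conjugate of b is ⁅x, b⁆ * b, and the central factor ⁅x, b⁆ lies in F.
  have hBfin : ∀ b ∈ B, ((fun x => x * b * x⁻¹) '' (B : Set (Module.End k V)ˣ)).Finite := by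
    intro b hb
    refine (hF.image (fun z => z * b)).subset ?_
    rintro _ ⟨x, hx, rfl⟩
    have hmem : ⁅x, b⁆ ∈ B := B.mul_mem (hconj x (hBH hx) b hb) (B.inv_mem hb)
    exact ⟨⁅x, b⁆, hFmem _ (hBH hmem) b (hBH hb) x (hBH hx) (hcomm x hx b hb)
      (by simp [commutatorElement_def]), by simp [commutatorElement_def]⟩
  obtain ⟨s, hsB, hs⟩ := exists_finset_commute B
  -- The centre of B is abelian and normalized by H.
  have hcenter : ∀ z ∈ B, (∀ x ∈ B, Commute z x) → ∀ h ∈ H, Commute h z := by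
    intro z hz hzB h hh
    refine commute_of_abelian_normal (A := B ⊓ Subgroup.centralizer B) hH hc
      (fun a ha b hb => ?_) (fun h hh a ha => ⟨hconj h hh a ha.1, ?_⟩) ⟨hz, ?_⟩ hh
    · exact (Subgroup.mem_centralizer_iff.mp hb.2 a ha.1)
    · refine Subgroup.mem_centralizer_iff.mpr fun x hx => ?_
      have h1 := Subgroup.mem_centralizer_iff.mp ha.2 _ (hconj h⁻¹ (H.inv_mem hh) x hx)
      calc x * (h * a * h⁻¹) = h * ((h⁻¹ * x * h⁻¹⁻¹) * a) * h⁻¹ := by group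
        _ = h * (a * (h⁻¹ * x * h⁻¹⁻¹)) * h⁻¹ := by rw [h1]
        _ = h * a * h⁻¹ * x := by group
    · exact Subgroup.mem_centralizer_iff.mpr fun x hx => (hzB x hx).eq.symm
  let f : (Module.End k V)ˣ → (s → (Module.End k V)ˣ) := fun y x => y * x * y⁻¹
  refine hc b (Set.Finite.of_finite_fibers f ?_ ?_) h hh
  · refine (Set.Finite.pi' fun x : s => hBfin x (hsB x.2)).subset ?_
    rintro _ ⟨_, ⟨g, hg, rfl⟩, rfl⟩ x
    exact ⟨_, hconj g hg b hb, rfl⟩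
  · rintro _ ⟨_, ⟨g, hg, rfl⟩, rfl⟩
    refine (hF.image fun z => z * (g * b * g⁻¹)).subset ?_
    rintro _ ⟨⟨g', hg', rfl⟩, hff⟩
    simp only [Set.mem_preimage, Set.mem_singleton_iff] at hff
    simp only
    have hyB := hconj g hg b hb
    have hyB' := hconj g' hg' b hb
    set y := g * b * g⁻¹ with hy
    set y' := g' * b * g'⁻¹ with hy'
    have hzB : y⁻¹ * y' ∈ B := B.mul_mem (B.inv_mem hyB) hyB'
    have hz : ∀ h ∈ H, Commute h (y⁻¹ * y') := by
      refine hcenter _ hzB (hs _ fun x hx => ?_)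
      have h1 : y' * x * y'⁻¹ = y * x * y⁻¹ := congrFun hff ⟨x, hx⟩
      change y⁻¹ * y' * x = x * (y⁻¹ * y')
      calc y⁻¹ * y' * x = y⁻¹ * (y' * x * y'⁻¹) * y' := by group
        _ = y⁻¹ * (y * x * y⁻¹) * y' := by rw [h1]
        _ = x * (y⁻¹ * y') := by group
    have hzy : y⁻¹ * y' * y = y' := by
      rw [← (hz y (hBH hyB)).eq, mul_inv_cancel_left]
    -- Conjugation by g' g⁻¹ carries y to y' = (y⁻¹ y') y, so the central factor belongs to F.
    refine ⟨y⁻¹ * y', hFmem _ (hBH hzB) y (hBH hyB) (g' * g⁻¹)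
      (H.mul_mem hg' (H.inv_mem hg)) hz ?_, hzy⟩
    rw [hzy, hy, hy']
    group

/-- Centrality climbs the derived series: if term n + 1 is central in H, then term n has central
commutators and so is central too. At term 0 this says that H is abelian. -/
theorem commute_of_isSolvable {H : Subgroup (Module.End k V)ˣ}
    (hH : IsStronglyIrreducible H) (hc : FiniteConjCentral H) (hs : Group.IsSolvable H) :
    ∀ a ∈ H, ∀ b ∈ H, a * b = b * a := by
  obtain ⟨n, hn⟩ := hs.solvable
  have key : ∀ n, derivedSeries H n ≤ Subgroup.center H →
      derivedSeries H 0 ≤ Subgroup.center H := by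
    intro n
    induction n with
    | zero => exact id
    | succ n ih =>
      refine fun hle => ih fun b hb => ?_
      have hnorm : (derivedSeries H n).Normal := inferInstance
      rw [Subgroup.mem_center_iff]
      intro h
      apply Subtype.ext
      refine (commute_of_central_commutators (B := (derivedSeries H n).map H.subtype) hH hc
        (Subgroup.map_subtype_le _) ?_ ?_ ⟨b, hb, rfl⟩ h.2).eq
      · rintro h hh _ ⟨x, hx, rfl⟩
        exact ⟨_, hnorm.conj_mem x hx ⟨h, hh⟩, rfl⟩
      · rintro _ ⟨x, hx, rfl⟩ _ ⟨y, hy, rfl⟩ h hh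
        have h1 : ⁅x, y⁆ ∈ Subgroup.center H := hle (Subgroup.commutator_mem_commutator hx hy)
        exact congrArg Subtype.val (Subgroup.mem_center_iff.mp h1 ⟨h, hh⟩)
  have h0 := key n (hn ▸ bot_le)
  intro a ha b hb
  have h1 : (⟨b, hb⟩ : H) ∈ Subgroup.center H := h0 (Subgroup.mem_top _)
  exact congrArg Subtype.val (Subgroup.mem_center_iff.mp h1 ⟨a, ha⟩)

/-- A solvable linear group all of whose subgroups of finite index are irreducible is
virtually abelian. -/
theorem IsStronglyIrreducible.exists_abelian {G : Subgroup (Module.End k V)ˣ}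
    (hG : IsStronglyIrreducible G) (hs : Group.IsSolvable G) :
    ∃ H ≤ G, H.relIndex G ≠ 0 ∧ ∀ a ∈ H, ∀ b ∈ H, a * b = b * a := by
  let E : Subgroup (Module.End k V)ˣ → Subalgebra k (Module.End k V) := fun N =>
    Algebra.adjoin k (Units.val '' (N : Set (Module.End k V)ˣ))
  -- Among the subgroups of finite index, H is chosen with enveloping algebra of least dimension.
  have hex : ∃ d : ℕ, ∃ H ≤ G, H.relIndex G ≠ 0 ∧ Module.finrank k (E H) = d :=
    ⟨_, G, le_rfl, by simp, rfl⟩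
  classical
  obtain ⟨H, hHG, hidx, hd⟩ := Nat.find_spec hex
  refine ⟨H, hHG, hidx, commute_of_isSolvable (hG.mono hHG hidx) ?_ ?_⟩
  · intro x hx h hh
    -- If x has finitely many H-conjugates, its centralizer in H has finite index. By minimality
    -- that centralizer has the same enveloping algebra as H, so x commutes with all of H.
    have hN : (H ⊓ Subgroup.centralizer {x}).relIndex H ≠ 0 := by
      rw [Subgroup.inf_relIndex_left]
      refine relIndex_ne_zero_of_finite_image H _ _ hx fun g _ g' _ hgg => ?_
      rw [Subgroup.mem_centralizer_singleton_iff]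
      calc g⁻¹ * g' * x = g⁻¹ * (g' * x * g'⁻¹) * g' := by group
        _ = g⁻¹ * (g * x * g⁻¹) * g' := by rw [hgg]
        _ = x * (g⁻¹ * g') := by group
    have hle : E (H ⊓ Subgroup.centralizer {x}) ≤ E H :=
      Algebra.adjoin_mono (Set.image_mono fun y hy => hy.1)
    have hmin := Nat.find_min' hex ⟨_, inf_le_left.trans hHG,
      Subgroup.relIndex_ne_zero_trans hN hidx, rfl⟩
    rw [← hd] at hmin
    have heq := Subalgebra.eq_of_le_of_finrank_le hle hmin
    have hmem : (h : Module.End k V) ∈ E (H ⊓ Subgroup.centralizer {x}) := by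
      rw [heq]; exact Algebra.subset_adjoin ⟨h, hh, rfl⟩
    have h2 : Commute (x : Module.End k V) h := by
      refine commute_of_mem_adjoin ?_ hmem
      rintro _ ⟨y, hy, rfl⟩
      exact congrArg Units.val (Subgroup.mem_centralizer_singleton_iff.mp hy.2).symm
    exact Units.ext h2.eq.symm
  · exact Group.isSolvable_of_isSolvable_injective (Subgroup.inclusion_injective hHG)

end SolvableLinearGroups

/-! ### Groups preserving a lattice in a rational vector space -/

section Lattices

universe u

theorem AllSubgroupsFG.prod {A B : Type*} [Group A] [Group B] (hA : AllSubgroupsFG A)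
    (hB : AllSubgroupsFG B) : AllSubgroupsFG (A × B) := by
  refine AllSubgroupsFG.of_hom (MonoidHom.fst A B) hA
    (AllSubgroupsFG.of_injective ((MonoidHom.snd A B).comp (MonoidHom.fst A B).ker.subtype) ?_ hB)
  rintro ⟨x, hx⟩ ⟨y, hy⟩ hxy
  have hx' : x.1 = 1 := hx
  have hy' : y.1 = 1 := hy
  exact Subtype.ext (Prod.ext (hx'.trans hy'.symm) hxy)

variable {V : Type u} [AddCommGroup V] [Module ℚ V]

/-- `L` is a finitely generated additive subgroup spanning `V` over `ℚ`. -/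
def IsRationalLattice (L : Submodule ℤ V) : Prop :=
  L.FG ∧ Submodule.span ℚ (L : Set V) = ⊤

theorem IsRationalLattice.exists_smul_mem {L : Submodule ℤ V} (hL : IsRationalLattice L) (v : V) :
    ∃ n : ℤ, n ≠ 0 ∧ n • v ∈ L := by
  have hv : v ∈ Submodule.span ℚ (L : Set V) := hL.2 ▸ Submodule.mem_top
  induction hv using Submodule.span_induction with
  | mem x hx => exact ⟨1, one_ne_zero, by simpa using hx⟩
  | zero => exact ⟨1, one_ne_zero, by simp⟩
  | add x y _ _ hx hy =>
    obtain ⟨m, hm, hmx⟩ := hx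
    obtain ⟨n, hn, hny⟩ := hy
    refine ⟨m * n, mul_ne_zero hm hn, ?_⟩
    rw [smul_add, mul_comm m n, mul_smul, mul_comm n m, mul_smul]
    exact L.add_mem (L.smul_mem _ hmx) (L.smul_mem _ hny)
  | smul q x _ hx =>
    obtain ⟨m, hm, hmx⟩ := hx
    -- The factor `q.den` clears the denominator of the scalar q.
    refine ⟨m * q.den, mul_ne_zero hm (by exact_mod_cast q.den_nz), ?_⟩
    have h1 : (m * q.den : ℤ) • q • x = q.num • m • x := by
      rw [← Int.cast_smul_eq_zsmul ℚ, ← Int.cast_smul_eq_zsmul ℚ q.num,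
        ← Int.cast_smul_eq_zsmul ℚ m, smul_smul, smul_smul]
      congr 1
      push_cast
      rw [mul_assoc, mul_comm (q.den : ℚ), Rat.mul_den_eq_num, mul_comm]
    rw [h1]
    exact L.smul_mem _ hmx

theorem IsRationalLattice.comap_subtype {L : Submodule ℤ V} (hL : IsRationalLattice L) (W : Submodule ℚ V) :
    IsRationalLattice (L.comap (W.subtype.restrictScalars ℤ)) := by
  constructor
  · have : Module.Finite ℤ L := Module.Finite.iff_fg.mpr hL.1
    have : IsNoetherian ℤ L := isNoetherian_of_isNoetherianRing_of_finite ℤ _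
    let i : L.comap (W.subtype.restrictScalars ℤ) →ₗ[ℤ] L :=
      (W.subtype.restrictScalars ℤ).restrict fun x hx => hx
    have hi : Function.Injective i := fun x y hxy =>
      Subtype.ext (Subtype.ext (congrArg (fun z : L => (z : V)) hxy))
    exact Module.Finite.iff_fg.mp (Module.Finite.of_injective i hi)
  · rw [eq_top_iff]
    intro w _
    obtain ⟨n, hn, hw⟩ := hL.exists_smul_mem (w : V)
    have h1 : n • w ∈ Submodule.span ℚ (L.comap (W.subtype.restrictScalars ℤ) : Set W) :=
      Submodule.subset_span (by simpa using hw)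
    rw [← Int.cast_smul_eq_zsmul ℚ] at h1
    exact (Submodule.smul_mem_iff _ (Int.cast_ne_zero.mpr hn)).mp h1

theorem IsRationalLattice.map_mkQ {L : Submodule ℤ V} (hL : IsRationalLattice L) (W : Submodule ℚ V) :
    IsRationalLattice (L.map (W.mkQ.restrictScalars ℤ)) := by
  refine ⟨hL.1.map _, ?_⟩
  have h1 : ((L.map (W.mkQ.restrictScalars ℤ) : Submodule ℤ (V ⧸ W)) : Set (V ⧸ W)) =
      W.mkQ '' L := rfl
  rw [h1, ← Submodule.map_span, hL.2, Submodule.map_top, Submodule.range_mkQ]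

theorem IsRationalLattice.eq_of_eqOn {L : Submodule ℤ V} (hL : IsRationalLattice L) {f g : Module.End ℚ V}
    (h : ∀ v ∈ L, f v = g v) : f = g :=
  LinearMap.ext_on hL.2 h

/-- Every element of `G` maps `L` into itself. -/
def Stabilizes (G : Subgroup (Module.End ℚ V)ˣ) (L : Submodule ℤ V) : Prop :=
  ∀ g ∈ G, ∀ v ∈ L, (g : Module.End ℚ V) v ∈ L

/-- The restriction of g to the finitely generated module L satisfies a monic integral polynomial,
and L spans V. -/
theorem isIntegral_of_lattice {L : Submodule ℤ V} (hL : IsRationalLattice L) {g : Module.End ℚ V}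
    (hg : ∀ v ∈ L, g v ∈ L) : IsIntegral ℤ g := by
  have : Module.Finite ℤ L := Module.Finite.iff_fg.mpr hL.1
  let r : Module.End ℤ L := (g.restrictScalars ℤ).restrict hg
  obtain ⟨p, hp, hpr⟩ := Algebra.IsIntegral.isIntegral (R := ℤ) r
  refine ⟨p, hp, ?_⟩
  have key : ∀ (q : Polynomial ℤ) (v : L), (Polynomial.aeval g q) (v : V) =
      (Polynomial.aeval r q v : L) := by
    intro q
    induction q using Polynomial.induction_on' with
    | add p q hp hq => intro v; simp [hp, hq]
    | monomial n a =>
      intro v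
      have hpow : ∀ n : ℕ, (g ^ n) (v : V) = ((r ^ n) v : L) := by
        intro n
        induction n with
        | zero => simp
        | succ n ih => rw [pow_succ', pow_succ', Module.End.mul_apply, ih]; rfl
      simp [Polynomial.aeval_monomial, hpow, ← zsmul_eq_mul]
  rw [← Polynomial.aeval_def] at hpr ⊢
  refine hL.eq_of_eqOn fun v hv => ?_
  rw [key p ⟨v, hv⟩, hpr]
  simp

open NumberField in
-- G lies in a number field K inside End V. Its elements and their inverses preserve L, so they are
-- integral, and G embeds in the unit group of the ring of integers, which is finitely generated by
-- Dirichlet's unit theorem.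
theorem allSubgroupsFG_of_abelian_irreducible [FiniteDimensional ℚ V] [Nontrivial V]
    {G : Subgroup (Module.End ℚ V)ˣ} (hG : IsIrreducibleGroup G)
    (hcomm : ∀ a ∈ G, ∀ b ∈ G, a * b = b * a) {L : Submodule ℤ V} (hL : IsRationalLattice L)
    (hGL : Stabilizes G L) : AllSubgroupsFG G := by
  obtain ⟨K, _, _, φ, hfin, hφ, hr⟩ := hG.exists_field
    (S := Units.val '' (G : Set (Module.End ℚ V)ˣ))
    (by
      rintro _ ⟨x, hx, rfl⟩ _ ⟨y, hy, rfl⟩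
      exact congrArg Units.val (hcomm x hx y hy))
    (by
      rintro _ ⟨x, hx, rfl⟩ h hh
      exact congrArg Units.val (hcomm h hh x hx))
  have : CharZero K := algebraRat.charZero K
  have : NumberField K :=
    { to_charZero := inferInstance
      to_finiteDimensional := by
        -- The ℚ-structure that comes with K agrees with the canonical one, since such a structure
        -- is unique.
        convert hfin
        · rfl
        · rfl
        · exact Subsingleton.elim _ _ }
  have hex : ∀ g : G, ∃ κ : K, φ κ = (g : (Module.End ℚ V)ˣ).val := fun g => by
    have : ((g : (Module.End ℚ V)ˣ) : Module.End ℚ V) ∈ φ.range := by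
      rw [hr]; exact Algebra.subset_adjoin ⟨g, g.2, rfl⟩
    exact this
  choose κ hκ using hex
  have hint : ∀ g, IsIntegral ℤ (κ g) := fun g => by
    have h1 := isIntegral_of_lattice hL (hGL g g.2)
    rw [← hκ] at h1
    exact (isIntegral_algHom_iff (φ.restrictScalars ℤ) hφ).mp h1
  let ψ : G →* 𝓞 K :=
    { toFun := fun g => ⟨κ g, hint g⟩
      map_one' := RingOfIntegers.ext (hφ (by
        change φ (κ 1) = φ 1
        rw [hκ, map_one]; rfl))
      map_mul' := fun a b => RingOfIntegers.ext (hφ (by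
        change φ (κ (a * b)) = φ (κ a * κ b)
        rw [map_mul, hκ, hκ, hκ]; rfl)) }
  have : Group.FG (𝓞 K)ˣ := Group.fg_iff_monoid_fg.mpr inferInstance
  refine AllSubgroupsFG.of_injective ψ.toHomUnits (fun a b hab => ?_)
    (AllSubgroupsFG.of_commGroup (𝓞 K)ˣ)
  have h1 : ψ a = ψ b := congrArg Units.val hab
  have h2 : κ a = κ b := congrArg (fun x : 𝓞 K => (x : K)) h1
  exact Subtype.ext (Units.ext (by rw [← hκ, ← hκ, h2]))

/-! ### Reduction along an invariant subspace, and the induction on dimension -/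

/-- The action of `G` on an invariant subspace. -/
def restrictHom {G : Subgroup (Module.End ℚ V)ˣ} {W : Submodule ℚ V}
    (hW : ∀ g ∈ G, ∀ w ∈ W, (g : Module.End ℚ V) w ∈ W) : G →* (Module.End ℚ W)ˣ :=
  MonoidHom.toHomUnits
    { toFun := fun g => (g : (Module.End ℚ V)ˣ).val.restrict (hW g g.2)
      map_one' := rfl
      map_mul' := fun _ _ => rfl }

/-- The action of `G` on the quotient by an invariant subspace. -/
def quotientHom {G : Subgroup (Module.End ℚ V)ˣ} {W : Submodule ℚ V}
    (hW : ∀ g ∈ G, ∀ w ∈ W, (g : Module.End ℚ V) w ∈ W) : G →* (Module.End ℚ (V ⧸ W))ˣ :=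
  MonoidHom.toHomUnits
    { toFun := fun g => W.mapQ W (g : (Module.End ℚ V)ˣ).val (hW g g.2)
      map_one' := by ext; rfl
      map_mul' := fun _ _ => by ext; rfl }

theorem coe_restrictHom {G : Subgroup (Module.End ℚ V)ˣ} {W : Submodule ℚ V}
    (hW : ∀ g ∈ G, ∀ w ∈ W, (g : Module.End ℚ V) w ∈ W) (g : G) (w : W) :
    (((restrictHom hW g).val w : W) : V) = (g : (Module.End ℚ V)ˣ).val w := rfl

theorem quotientHom_mkQ {G : Subgroup (Module.End ℚ V)ˣ} {W : Submodule ℚ V}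
    (hW : ∀ g ∈ G, ∀ w ∈ W, (g : Module.End ℚ V) w ∈ W) (g : G) (v : V) :
    (quotientHom hW g).val (W.mkQ v) = W.mkQ ((g : (Module.End ℚ V)ˣ).val v) := rfl

/-- For a, b in N the product (a - 1)(b - 1) vanishes, as b - 1 maps V into W and a fixes W
pointwise. Hence g ↦ g - 1 turns products into sums and embeds N in the finitely generated abelian
group End L. -/
theorem allSubgroupsFG_ker {G : Subgroup (Module.End ℚ V)ˣ} {W : Submodule ℚ V}
    (hW : ∀ g ∈ G, ∀ w ∈ W, (g : Module.End ℚ V) w ∈ W) {L : Submodule ℤ V}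
    (hL : IsRationalLattice L) (hGL : Stabilizes G L) {N : Subgroup G}
    (h1 : N ≤ (restrictHom hW).ker) (h2 : N ≤ (quotientHom hW).ker) : AllSubgroupsFG N := by
  have hfin : Module.Finite ℤ L := Module.Finite.iff_fg.mpr hL.1
  have : IsAddTorsionFree V := .of_module_rat V
  have hfree : Module.Free ℤ L := inferInstance
  have hfg : Group.FG (Multiplicative (L →ₗ[ℤ] L)) := by
    rw [← AddGroup.fg_iff_mul_fg, ← Module.Finite.iff_addGroup_fg]
    infer_instance
  have hone : ∀ g ∈ N, ∀ w ∈ W, (g : (Module.End ℚ V)ˣ).val w = w := fun g hg w hw => by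
    rw [← coe_restrictHom hW g ⟨w, hw⟩, (MonoidHom.mem_ker).mp (h1 hg)]
    rfl
  have hsub : ∀ g ∈ N, ∀ v, (g : (Module.End ℚ V)ˣ).val v - v ∈ W := fun g hg v => by
    have := quotientHom_mkQ hW g v
    rw [(MonoidHom.mem_ker).mp (h2 hg)] at this
    exact (Submodule.Quotient.eq W).mp this.symm
  have hL' : ∀ g : N, ∀ v ∈ L, ((g : G) : (Module.End ℚ V)ˣ).val v ∈ L := fun g => hGL g g.1.2
  let d : N → (L →ₗ[ℤ] L) := fun g =>
    (((g : G) : (Module.End ℚ V)ˣ).val.restrictScalars ℤ).restrict (hL' g) - LinearMap.id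
  have hd : ∀ g (v : L), (d g v : V) = ((g : G) : (Module.End ℚ V)ˣ).val v - v := fun _ _ => rfl
  let D : N →* Multiplicative (L →ₗ[ℤ] L) :=
    { toFun := fun g => Multiplicative.ofAdd (d g)
      map_one' := by
        rw [← ofAdd_zero]
        congr 1
        ext v
        rw [hd]
        simp
      map_mul' := fun a b => by
        rw [← ofAdd_add]
        congr 1
        ext v
        rw [LinearMap.add_apply, Submodule.coe_add, hd, hd, hd]
        have h3 := hone a a.2 _ (hsub b b.2 v)
        rw [map_sub, sub_eq_sub_iff_add_eq_add] at h3
        have h4 : (((a * b : N) : G) : (Module.End ℚ V)ˣ).val (v : V) =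
          ((a : G) : (Module.End ℚ V)ˣ).val (((b : G) : (Module.End ℚ V)ˣ).val v) := rfl
        rw [h4, eq_sub_of_add_eq h3]
        abel }
  refine AllSubgroupsFG.of_injective D (fun a b hab => ?_) (AllSubgroupsFG.of_commGroup _)
  refine Subtype.ext (Subtype.ext (Units.ext (hL.eq_of_eqOn fun v hv => ?_)))
  have h3 : d a = d b := hab
  have h4 := hd a ⟨v, hv⟩
  rw [h3, hd] at h4
  exact (sub_left_injective h4).symm

/-- Reduction along an invariant subspace. -/
theorem allSubgroupsFG_of_invariant {G : Subgroup (Module.End ℚ V)ˣ} {W : Submodule ℚ V}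
    (hW : ∀ g ∈ G, ∀ w ∈ W, (g : Module.End ℚ V) w ∈ W) {L : Submodule ℤ V}
    (hL : IsRationalLattice L) (hGL : Stabilizes G L)
    (h1 : AllSubgroupsFG (restrictHom hW).range) (h2 : AllSubgroupsFG (quotientHom hW).range) :
    AllSubgroupsFG G := by
  let f := (restrictHom hW).rangeRestrict.prod (quotientHom hW).rangeRestrict
  refine AllSubgroupsFG.of_hom f (h1.prod h2) (allSubgroupsFG_ker hW hL hGL ?_ ?_)
  · intro g hg
    exact congrArg (fun x => (x.1 : (Module.End ℚ W)ˣ)) (MonoidHom.mem_ker.mp hg)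
  · intro g hg
    exact congrArg (fun x => (x.2 : (Module.End ℚ (V ⧸ W))ˣ)) (MonoidHom.mem_ker.mp hg)

theorem AllSubgroupsFG.of_relIndex {G : Type*} [Group G] {H K : Subgroup G} (hle : H ≤ K)
    (hidx : H.relIndex K ≠ 0) (hH : AllSubgroupsFG H) : AllSubgroupsFG K := by
  have : (H.subgroupOf K).FiniteIndex := ⟨hidx⟩
  refine AllSubgroupsFG.of_finiteIndex (H.subgroupOf K) ?_
  have e := Subgroup.subgroupOfEquivOfLe hle
  exact AllSubgroupsFG.of_injective e.toMonoidHom e.injective hH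

/-- A solvable group of linear transformations stabilizing a lattice has only finitely
generated subgroups. -/
theorem allSubgroupsFG_of_isSolvable (n : ℕ) :
    ∀ (V : Type u) [AddCommGroup V] [Module ℚ V] [FiniteDimensional ℚ V]
      (G : Subgroup (Module.End ℚ V)ˣ) (L : Submodule ℤ V), Module.finrank ℚ V = n →
      Group.IsSolvable G → IsRationalLattice L → Stabilizes G L → AllSubgroupsFG G := by
  induction n using Nat.strong_induction_on with
  | _ n ih =>
    intro V _ _ _ G L hn hs hL hGL
    rcases subsingleton_or_nontrivial V with hV | hV
    -- In dimension zero G is trivial, so it embeds in any group, for instance the infinite cyclic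
    -- one.
    · have : Subsingleton G := ⟨fun a b => Subtype.ext (Units.ext (LinearMap.ext fun v =>
        Subsingleton.elim _ _))⟩
      exact AllSubgroupsFG.of_injective (1 : G →* Multiplicative ℤ)
        (Function.injective_of_subsingleton _) (AllSubgroupsFG.of_commGroup _)
    by_cases hG : IsStronglyIrreducible G
    · obtain ⟨H, hHG, hidx, hcomm⟩ := hG.exists_abelian hs
      exact AllSubgroupsFG.of_relIndex hHG hidx (allSubgroupsFG_of_abelian_irreducible
        (hG H hHG hidx) hcomm hL fun g hg => hGL g (hHG hg))
    · simp only [IsStronglyIrreducible, IsIrreducibleGroup] at hG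
      push Not at hG
      -- Failure of strong irreducibility supplies H of finite index with an invariant W; both W and
      -- V/W have smaller dimension.
      obtain ⟨H, hHG, hidx, W, hW, hbot, htop⟩ := hG
      have hHL : Stabilizes H L := fun g hg => hGL g (hHG hg)
      have hHs : Group.IsSolvable H :=
        Group.isSolvable_of_isSolvable_injective (Subgroup.inclusion_injective hHG)
      refine AllSubgroupsFG.of_relIndex hHG hidx (allSubgroupsFG_of_invariant hW hL hHL ?_ ?_)
      · refine ih _ (hn ▸ Submodule.finrank_lt htop) W _ (L.comap (W.subtype.restrictScalars ℤ))
          rfl (Group.isSolvable_of_surjective (MonoidHom.rangeRestrict_surjective _))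
          (hL.comap_subtype W) ?_
        rintro _ ⟨g, rfl⟩ w hw
        exact hHL g g.2 w hw
      · have hlt : Module.finrank ℚ (V ⧸ W) < n := by
          have h1 := Submodule.finrank_quotient_add_finrank W
          have h2 : 0 < Module.finrank ℚ W := by
            have := (Submodule.nontrivial_iff_ne_bot (p := W)).mpr hbot
            exact Module.finrank_pos
          omega
        refine ih _ hlt (V ⧸ W) _ (L.map (W.mkQ.restrictScalars ℤ)) rfl
          (Group.isSolvable_of_surjective (MonoidHom.rangeRestrict_surjective _))
          (hL.map_mkQ W) ?_
        rintro _ ⟨g, rfl⟩ _ ⟨v, hv, rfl⟩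
        exact ⟨_, hHL g g.2 v hv, rfl⟩

end Lattices

/-! ### Integral unimodular matrices acting on ℚⁿ -/

theorem isRationalLattice_span_basisFun (n : ℕ) :
    IsRationalLattice (Submodule.span ℤ (Set.range (Pi.basisFun ℚ (Fin n)))) := by
  refine ⟨Submodule.fg_span (Set.finite_range _), ?_⟩
  rw [Submodule.span_span_of_tower, (Pi.basisFun ℚ (Fin n)).span_eq]

/-- An integral unimodular matrix as a linear automorphism of `ℚⁿ`. -/
def unimodularToEnd (n : ℕ) :
    Matrix.GeneralLinearGroup (Fin n) ℤ →* (Module.End ℚ (Fin n → ℚ))ˣ :=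
  (Units.map (Matrix.toLinAlgEquiv' (R := ℚ) (n := Fin n)).toAlgHom.toMonoidHom).comp
    (Units.map (Int.castRingHom ℚ).mapMatrix.toMonoidHom)

theorem unimodularToEnd_apply (n : ℕ) (g : Matrix.GeneralLinearGroup (Fin n) ℤ)
    (v : Fin n → ℚ) :
    (unimodularToEnd n g).val v = (g.val.map (Int.cast : ℤ → ℚ)).mulVec v := rfl

theorem unimodularToEnd_injective (n : ℕ) : Function.Injective (unimodularToEnd n) := by
  refine (Units.map_injective (Matrix.toLinAlgEquiv' (R := ℚ) (n := Fin n)).injective).comp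
    (Units.map_injective ?_)
  exact Matrix.map_injective Int.cast_injective

theorem theorem9p8 (n : ℕ) (G : Subgroup (Matrix.GeneralLinearGroup (Fin n) ℤ))
    (hG : Group.IsSolvable G) : IsPolycyclic G := by
  refine AllSubgroupsFG.isPolycyclic ?_ hG
  let f := (unimodularToEnd n).comp G.subtype
  have hf : Function.Injective f := (unimodularToEnd_injective n).comp G.subtype_injective
  refine AllSubgroupsFG.of_injective f.rangeRestrict
    ((MonoidHom.rangeRestrict_injective_iff).mpr hf)
    (allSubgroupsFG_of_isSolvable n (Fin n → ℚ) f.range _ (by simp)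
      (Group.isSolvable_of_surjective f.rangeRestrict_surjective)
      (isRationalLattice_span_basisFun n) ?_)
  rintro _ ⟨g, rfl⟩ v hv
  rw [Module.Basis.mem_span_iff_repr_mem] at hv ⊢
  intro i
  choose c hc using hv
  simp only [Pi.basisFun_repr] at hc ⊢
  -- An integer matrix applied to a vector with integer coordinates c has these integer coordinates.
  refine ⟨∑ j, g.1.val i j * c j, ?_⟩
  change _ = ((unimodularToEnd n g).val v) i
  rw [unimodularToEnd_apply, Matrix.mulVec, dotProduct]
  simp [← hc]
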